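/- There is an absolute constant $C$ with the following property. Let $n$ be an odd positive integer and let $L=\bigoplus_{i\in\mathbb Z/n\mathbb Z}L_i$ be a $(\mathbb Z/n\mathbb Z)$-graded Lie algebra (of arbitrary dimension) over an arbitrary field, i.e. the $L_i$ are subspaces with $[L_i,L_j]\subseteq L_{i+j}$ for all $i,j\in\mathbb Z/n\mathbb Z$. Suppose that $L_0=0$ and that $L$ satisfies the selective metabelian condition: $\big[[L_{d_1},L_{d_2}],[L_{d_3},L_{d_4}]\big]=0$ for all $d_1,d_2,d_3,d_4\in\mathbb Z/n\mathbb Z$ such that the sequence $(d_1,d_2,d_3,d_4)$ is $(-1)$-independent, meaning that for $t_1,\dots,t_4\in\{0,1\}$ the equality $t_1d_1+t_2d_2+t_3d_3+t_4d_4=0$ holds only if $t_1=t_2=t_3=t_4=0$. Then $L$ is solvable of derived length at most $C$, i.e. $L^{(C)}=0$, where $L^{(0)}=L$ and $L^{(k+1)}=[L^{(k)},L^{(k)}]$. In particular, $C$ does not depend on $n$, on the field or on $L$. -/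

import Mathlib

/-- A finite sequence `a` of residues modulo `n` is `(-1)`-independent if
`t_1 a_1 + ⋯ + t_k a_k = 0` with all `t_i ∈ {0, 1}` forces all `t_i` to vanish; the set `s` is
the set of the indices `i` with `t_i = 1`. -/
def IsNegOneIndependent {n k : ℕ} (a : Fin k → ZMod n) : Prop :=
  ∀ s : Finset (Fin k), ∑ i ∈ s, a i = 0 → s = ∅

/-- The selective metabelian condition on a family of subspaces `L_i`, `i ∈ ℤ/nℤ`, of a Lie
algebra: `[[L_{d_1}, L_{d_2}], [L_{d_3}, L_{d_4}]] = 0` whenever `(d_1, d_2, d_3, d_4)` is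
`(-1)`-independent. -/
def SelectiveMetabelian {n : ℕ} {K L : Type*} [Field K] [LieRing L] [LieAlgebra K L]
    (𝓛 : ZMod n → Submodule K L) : Prop :=
  ∀ d₁ d₂ d₃ d₄ : ZMod n, IsNegOneIndependent ![d₁, d₂, d₃, d₄] →
    ∀ x₁ ∈ 𝓛 d₁, ∀ x₂ ∈ 𝓛 d₂, ∀ x₃ ∈ 𝓛 d₃, ∀ x₄ ∈ 𝓛 d₄, ⁅⁅x₁, x₂⁆, ⁅x₃, x₄⁆⁆ = 0

/-!
Graded subspaces are handled componentwise, as families of subspaces indexed by residues; a family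
is a Lie family if `[𝓕_a, 𝓕_b] ⊆ 𝓕_{a+b}`. Kreknin's theorem, in the form `derived_kreknin_le`,
says that if `𝓕_0` and all but `d` of the components of a Lie family lie in an ideal, then so does
the derived subalgebra of level `2 ^ d - 1`.

The main tool is an elimination theorem, `Cosupported.derived_le`. Suppose that `𝓕_0 = 0` and that
the subalgebra `C` contains all components of `𝓕` except those with indices from a set `F` of `m`
residues, and that `F` contains no coset of a nontrivial subgroup. Then a term of the derived
series of `𝓕`, whose level depends on `m` only, lies in `C`. For the proof, consider the action of
`C` on the quotient of `𝓕` by `C`. A homogeneous element of index `δ ≠ 0` acts nilpotently, because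
the progression `h, h + δ, h + 2δ, …` leaves `F` after at most `m` steps; elements with index
outside of `F - F` act trivially; and by Kreknin's theorem a term of the derived series of `C` acts
trivially. Together these facts bound the nilpotency index of the action
(`Cosupported.iSup_adFamily_pow_le`). On the other hand, induction on `m` shows that the derived
series of `𝓕` descends along the series `C + [… [𝓕, C] …, C]`: adjoining one full component `𝓕_f`
to `C` removes an index from `F`, and in a product of index `f` the component `𝓕_f` cannot occur as
the last factor, since the other one would have index zero.

If all products `[𝓛_a, 𝓛_{i-a}]` with `a ∉ F` lie in a subspace `Y`, then the elements of `𝓛_a`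
which are mapped into `Y` by `𝓛_{i-a}` form such a subalgebra, so that the component of index `i`
of a term of the derived series lies in `Y` (`derived_apply_le`). Under the selective metabelian
condition this is used twice. First, with `F = {-i, i + j}`, it reduces the commutation of the
components of indices `i` and `j` to the identity `[x, [u, v]] = 0` with `u ∈ 𝓛_p`, `v ∈ 𝓛_q`,
`p + q = j`, `p ∉ F`. Second, for fixed `u` and `v`, the elements commuting with `[u, v]` contain
`[𝓛_a, 𝓛_{i-a}]` unless `a` is one of six exceptional residues. Apart from cases in which a product
vanishes trivially because of `𝓛_0 = 0`, the residue `0` is not among these six, and then, as `n` is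
odd, they contain no coset of a nontrivial subgroup, unless `i` and `j` satisfy one of three linear
relations (`cosetFree_exceptional`). If they do, and `j` and `i` do as well, then `45 (i + j) = 0`. Hence one
step further in the derived series at most `45` components survive, and Kreknin's theorem finishes
the proof.
-/

/-! ### Families of homogeneous components -/

namespace LieFamily

section Basic

variable {A K L : Type*} [AddCommGroup A] [Field K] [LieRing L] [LieAlgebra K L]

/-- A family of subspaces indexed by an additive group is a *Lie family* if `[𝓕_a, 𝓕_b]` lies in
`𝓕_{a+b}`. The homogeneous components of a graded subalgebra form such a family. -/
def IsLie (𝓕 : A → Submodule K L) : Prop :=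
  ∀ ⦃a b x y⦄, x ∈ 𝓕 a → y ∈ 𝓕 b → ⁅x, y⁆ ∈ 𝓕 (a + b)

/-- The component of index `a` is the sum of the subspaces `[𝓕_b, 𝓖_c]` with `b + c = a`. -/
def bracket (𝓕 𝓖 : A → Submodule K L) (a : A) : Submodule K L :=
  Submodule.span K {z | ∃ b c, b + c = a ∧ ∃ x ∈ 𝓕 b, ∃ y ∈ 𝓖 c, ⁅x, y⁆ = z}

/-- The derived series of a family. -/
def derived (𝓕 : A → Submodule K L) (k : ℕ) : A → Submodule K L :=
  (fun 𝓖 => bracket 𝓖 𝓖)^[k] 𝓕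

variable {𝓕 𝓖 𝓕' 𝓖' X Y : A → Submodule K L}

lemma lie_mem_bracket {a b c : A} {x y : L} (hx : x ∈ 𝓕 b) (hy : y ∈ 𝓖 c) (h : b + c = a) :
    ⁅x, y⁆ ∈ bracket 𝓕 𝓖 a :=
  Submodule.subset_span ⟨b, c, h, x, hx, y, hy, rfl⟩

lemma bracket_le {a : A} {S : Submodule K L}
    (h : ∀ b c, b + c = a → ∀ x ∈ 𝓕 b, ∀ y ∈ 𝓖 c, ⁅x, y⁆ ∈ S) : bracket 𝓕 𝓖 a ≤ S := by
  refine Submodule.span_le.2 ?_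
  rintro _ ⟨b, c, hbc, x, hx, y, hy, rfl⟩
  exact h b c hbc x hx y hy

lemma bracket_mono (h : 𝓕 ≤ 𝓕') (h' : 𝓖 ≤ 𝓖') : bracket 𝓕 𝓖 ≤ bracket 𝓕' 𝓖' := fun _ =>
  bracket_le fun _ _ hbc _ hx _ hy => lie_mem_bracket (h _ hx) (h' _ hy) hbc

lemma IsLie.bracket_le_self (h : IsLie 𝓕) : bracket 𝓕 𝓕 ≤ 𝓕 := fun _ =>
  bracket_le fun _ _ hbc _ hx _ hy => hbc ▸ h hx hy

lemma IsLie.bracket_self (h : IsLie 𝓕) : IsLie (bracket 𝓕 𝓕) := fun _ _ _ _ hx hy =>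
  lie_mem_bracket (h.bracket_le_self _ hx) (h.bracket_le_self _ hy) rfl

@[simp] lemma derived_zero : derived 𝓕 0 = 𝓕 := rfl

lemma derived_succ (k : ℕ) : derived 𝓕 (k + 1) = bracket (derived 𝓕 k) (derived 𝓕 k) :=
  Function.iterate_succ_apply' _ _ _

lemma derived_add (k l : ℕ) : derived 𝓕 (k + l) = derived (derived 𝓕 l) k :=
  Function.iterate_add_apply _ _ _ _

lemma IsLie.derived (h : IsLie 𝓕) (k : ℕ) : IsLie (derived 𝓕 k) := by
  induction k with
  | zero => exact h
  | succ k ih => rw [derived_succ]; exact ih.bracket_self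

lemma IsLie.derived_antitone (h : IsLie 𝓕) : Antitone (LieFamily.derived 𝓕) :=
  antitone_nat_of_succ_le fun k => by rw [derived_succ]; exact (h.derived k).bracket_le_self

lemma IsLie.derived_le (h : IsLie 𝓕) (k : ℕ) : LieFamily.derived 𝓕 k ≤ 𝓕 :=
  h.derived_antitone (Nat.zero_le k)

/-- Membership in the span of the left-normed words of index `a` in letters from the subspaces
`X_b`; the index of a word is the sum of the indices of its letters. -/
inductive IsWord (X : A → Submodule K L) : A → L → Prop
  | letter {a x} : x ∈ X a → IsWord X a x
  | zero a : IsWord X a 0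
  | add {a x y} : IsWord X a x → IsWord X a y → IsWord X a (x + y)
  | smul {a x} (k : K) : IsWord X a x → IsWord X a (k • x)
  | lie {a b w x} : IsWord X a w → x ∈ X b → IsWord X (a + b) ⁅w, x⁆

/-- The Lie family generated by the subspaces `X_a`. It is described by left-normed words, because
the arguments below inspect the last letter of a word. -/
def gen (X : A → Submodule K L) (a : A) : Submodule K L where
  carrier := {x | IsWord X a x}
  zero_mem' := .zero a
  add_mem' := .add
  smul_mem' k _ := .smul k

lemma le_gen : X ≤ gen X := fun _ _ h => IsWord.letter h

lemma bracket_gen_le : bracket (gen X) X ≤ gen X := fun _ =>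
  bracket_le fun _ _ hbc _ hx _ hy => hbc ▸ IsWord.lie hx hy

/-- A product of two words is a combination of words of length at least two. -/
lemma lie_mem_bracket_gen {a b : A} {w v : L} (hw : w ∈ gen X a) (hv : v ∈ gen X b) :
    ⁅w, v⁆ ∈ bracket (gen X) X (a + b) := by
  induction hv generalizing a w with
  | letter hx => exact lie_mem_bracket hw hx rfl
  | zero => simp
  | add _ _ h₁ h₂ => rw [lie_add]; exact add_mem (h₁ hw) (h₂ hw)
  | smul k _ h => rw [lie_smul]; exact Submodule.smul_mem _ _ (h hw)
  | @lie b c v x hv hx ih =>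
    rw [leibniz_lie, ← lie_skew v ⁅w, x⁆]
    refine add_mem (lie_mem_bracket (bracket_gen_le _ (ih hw)) hx (add_assoc _ _ _)) (neg_mem ?_)
    have := ih (bracket_gen_le _ (lie_mem_bracket hw hx rfl))
    rwa [show a + (b + c) = a + c + b by abel]

lemma isLie_gen : IsLie (gen X) := fun _ _ _ _ hx hy =>
  bracket_gen_le _ (lie_mem_bracket_gen hx hy)

lemma gen_le (h : X ≤ 𝓕) (h𝓕 : IsLie 𝓕) : gen X ≤ 𝓕 := by
  intro a w hw
  induction hw with
  | letter hx => exact h _ hx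
  | zero => exact zero_mem _
  | add _ _ h₁ h₂ => exact add_mem h₁ h₂
  | smul k _ h => exact Submodule.smul_mem _ _ h
  | lie _ hx ih => exact h𝓕 ih (h _ hx)

end Basic

/-! ### Kreknin's theorem relative to an ideal -/

section Kreknin

variable {n : ℕ} {K L : Type*} [Field K] [LieRing L] [LieAlgebra K L]

/-- The letters which remain after the indices `b` with representative `b.val ≤ t` have been
eliminated: the elements of the ideal and the components `𝓕_b` with `b.val > t`. -/
def lettersAbove (𝓕 I : ZMod n → Submodule K L) (t : ℕ) (b : ZMod n) : Submodule K L :=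
  if t < b.val then 𝓕 b else 𝓕 b ⊓ I b

lemma lettersAbove_le (𝓕 I : ZMod n → Submodule K L) (t : ℕ) : lettersAbove 𝓕 I t ≤ 𝓕 := by
  intro b
  unfold lettersAbove
  split_ifs
  exacts [le_rfl, inf_le_left]

lemma inf_le_lettersAbove (𝓕 I : ZMod n → Submodule K L) (t : ℕ) (b : ZMod n) :
    𝓕 b ⊓ I b ≤ lettersAbove 𝓕 I t b := by
  unfold lettersAbove
  split_ifs
  exacts [inf_le_left, le_rfl]

variable [NeZero n]

/-- If `f` is the sum of `c` and `f - c`, and the representative of `c` exceeds that of `f`, then a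
wrap-around occurs, and the representative of `f - c` exceeds that of `f` as well. -/
lemma lt_val_sub {f c : ZMod n} (h : f.val < c.val) : f.val < (f - c).val := by
  have h1 : f = (f - c) + c := by abel
  by_contra! h2
  have h3 : (f - c).val + c.val < n ∨ n ≤ (f - c).val + c.val := lt_or_ge _ _
  rcases h3 with h3 | h3
  · have := ZMod.val_add_of_lt h3
    rw [← h1] at this
    omega
  · have := ZMod.val_add_val_of_le h3
    rw [← h1] at this
    have := ZMod.val_lt c
    have h0 : (f - c).val ≠ f.val := by
      intro h0
      have := ZMod.val_injective n h0
      have : c = 0 := by simpa using this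
      simp [this] at h
    have := ZMod.val_lt (f - c)
    omega

variable {𝓕 I : ZMod n → Submodule K L}

/-- In a word of index `f = t + 1` of length at least two in the letters of indices above `t`, the
last letter cannot have index `f`, because the component of index zero is trivial, and if it has
an index above `f`, so does the rest of the word. -/
lemma bracket_gen_lettersAbove_le (h𝓕 : IsLie 𝓕)
    (hI : ∀ a b x y, x ∈ 𝓕 a ⊓ I a → y ∈ 𝓕 b → ⁅x, y⁆ ∈ I (a + b)) (h0 : 𝓕 0 ≤ I 0) {f : ZMod n}
    {t : ℕ} (hf : f.val = t + 1) :
    bracket (gen (lettersAbove 𝓕 I t)) (lettersAbove 𝓕 I t) f ≤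
      gen (lettersAbove 𝓕 I (t + 1)) f := by
  have hgen : gen (lettersAbove 𝓕 I t) ≤ 𝓕 := gen_le (lettersAbove_le _ _ _) h𝓕
  refine bracket_le fun b c hbc x hx y hy => ?_
  have hx𝓕 := hgen _ hx
  have hy𝓕 := lettersAbove_le _ _ _ _ hy
  have hmem : ⁅x, y⁆ ∈ I f → ⁅x, y⁆ ∈ gen (lettersAbove 𝓕 I (t + 1)) f := fun h =>
    le_gen _ (inf_le_lettersAbove _ _ _ _ ⟨hbc ▸ h𝓕 hx𝓕 hy𝓕, h⟩)
  rcases lt_trichotomy c.val f.val with hc | hc | hc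
  · refine hmem ?_
    have hyI : y ∈ 𝓕 c ⊓ I c := by
      simpa [lettersAbove, show ¬ t < c.val by omega] using hy
    rw [← lie_skew, ← hbc, add_comm]
    exact neg_mem (hI _ _ _ _ hyI hx𝓕)
  · refine hmem ?_
    have hcf : c = f := ZMod.val_injective n hc
    have hb : b = 0 := by rw [hcf] at hbc; simpa using hbc
    subst hb
    exact hbc ▸ hI _ _ _ _ ⟨hx𝓕, h0 hx𝓕⟩ hy𝓕
  · have hb : f.val < b.val := by
      have := lt_val_sub hc
      rwa [← hbc, add_sub_cancel_right, hbc] at this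
    rw [← hbc]
    refine isLie_gen (le_gen _ ?_) (le_gen _ ?_)
    · simpa [lettersAbove, show t + 1 < b.val by omega] using hx𝓕
    · simpa [lettersAbove, show t + 1 < c.val by omega] using hy𝓕

/-- A bound for the derived length in Kreknin's theorem for `d` nontrivial components. -/
def kreknin (d : ℕ) : ℕ := 2 ^ d - 1

lemma kreknin_succ (d : ℕ) : kreknin (d + 1) = kreknin d + (kreknin d + 1) := by
  have : 0 < 2 ^ d := by positivity
  simp only [kreknin, pow_succ]
  omega

/-- Elimination of the components in the order of the representatives of their indices. A component
with an index outside of `B` costs nothing, since it lies in `I` from the start; every other one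
doubles the number of steps taken so far and adds one. -/
lemma derived_le_gen_lettersAbove
    (hI : ∀ a b x y, x ∈ 𝓕 a ⊓ I a → y ∈ 𝓕 b → ⁅x, y⁆ ∈ I (a + b)) (h0 : 𝓕 0 ≤ I 0)
    (B : Finset (ZMod n)) (hB : ∀ a ∉ B, 𝓕 a ≤ I a) (t : ℕ) :
    ∀ 𝓖 ≤ 𝓕, IsLie 𝓖 →
      derived 𝓖 (kreknin (B.filter fun a => a.val ≤ t).card) ≤ gen (lettersAbove 𝓖 I t) := by
  induction t with
  | zero =>
    refine fun 𝓖 h𝓖 hL => (hL.derived_le _).trans (le_trans ?_ le_gen)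
    intro a
    by_cases ha : 0 < a.val
    · simp [lettersAbove, ha]
    · have : a = 0 := by simpa using ha
      subst this
      exact le_trans (le_inf le_rfl ((h𝓖 _).trans h0)) (inf_le_lettersAbove _ _ _ _)
  | succ t ih =>
    intro 𝓖 h𝓖 hL
    by_cases hex : ∃ f ∈ B, f.val = t + 1
    · obtain ⟨f, hfB, hft⟩ := hex
      have hcard : (B.filter fun a => a.val ≤ t + 1).card
          = (B.filter fun a => a.val ≤ t).card + 1 := by
        have : (B.filter fun a => a.val ≤ t + 1) = insert f (B.filter fun a => a.val ≤ t) := by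
          ext a
          simp only [Finset.mem_filter, Finset.mem_insert]
          constructor
          · rintro ⟨ha, hat⟩
            by_cases h : a.val ≤ t
            · exact .inr ⟨ha, h⟩
            · exact .inl (ZMod.val_injective n (by omega))
          · rintro (rfl | ⟨ha, hat⟩)
            · exact ⟨hfB, hft.le⟩
            · exact ⟨ha, by omega⟩
        rw [this, Finset.card_insert_of_notMem (by simp [hft])]
      set k := (B.filter fun a => a.val ≤ t).card
      rw [hcard, kreknin_succ, derived_add]
      set 𝓖' := derived 𝓖 (kreknin k + 1) with h𝓖'
      have h𝓖'𝓖 : 𝓖' ≤ 𝓖 := hL.derived_le _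
      refine (ih 𝓖' (h𝓖'𝓖.trans h𝓖) (hL.derived _)).trans (gen_le ?_ isLie_gen)
      intro b
      by_cases hb : t < b.val
      · by_cases hbf : t + 1 < b.val
        · refine le_trans ?_ (le_gen b)
          simpa [lettersAbove, hb, hbf] using h𝓖'𝓖 b
        · have hbf : b = f := ZMod.val_injective n (by omega)
          subst hbf
          refine le_trans (lettersAbove_le _ _ _ b) (le_trans ?_ (bracket_gen_lettersAbove_le hL
            (fun a b x y hx hy => hI a b x y ⟨h𝓖 _ hx.1, hx.2⟩ (h𝓖 _ hy)) ((h𝓖 _).trans h0) hft))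
          rw [h𝓖', derived_succ]
          refine bracket_le fun p q hpq x hx y hy => hpq ▸ lie_mem_bracket_gen ?_ ?_
          exacts [ih 𝓖 h𝓖 hL _ hx, ih 𝓖 h𝓖 hL _ hy]
      · refine le_trans ?_ (le_gen b)
        have : lettersAbove 𝓖' I t b = 𝓖' b ⊓ I b := by simp [lettersAbove, hb]
        rw [this]
        exact le_trans (inf_le_inf_right _ (h𝓖'𝓖 b)) (inf_le_lettersAbove _ _ _ _)
    · push Not at hex
      have : (B.filter fun a => a.val ≤ t + 1) = B.filter fun a => a.val ≤ t := by
        ext a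
        simp only [Finset.mem_filter, and_congr_right_iff]
        intro ha
        have := hex a ha
        omega
      rw [this]
      refine (ih 𝓖 h𝓖 hL).trans (gen_le ?_ isLie_gen)
      refine le_trans ?_ le_gen
      intro b
      by_cases hb : t + 1 < b.val
      · simpa [lettersAbove, hb] using lettersAbove_le _ _ _ b
      · by_cases hbt : b.val = t + 1
        · refine le_trans (le_inf (lettersAbove_le _ _ _ b) ?_) (inf_le_lettersAbove _ _ _ _)
          exact (lettersAbove_le _ _ _ b).trans ((h𝓖 _).trans (hB b fun h => hex b h hbt))
        · simp [lettersAbove, hb, show ¬ t < b.val by omega]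

/-- **Kreknin's theorem**, relative to an ideal `I` and for families with few components outside
of it: if `𝓕_0 ⊆ I_0`, and `𝓕_a ⊆ I_a` except for at most `d` indices `a`, then the derived
subalgebra of level `2 ^ d - 1` lies in `I`. -/
theorem derived_kreknin_le (h𝓕 : IsLie 𝓕)
    (hI : ∀ a b x y, x ∈ 𝓕 a ⊓ I a → y ∈ 𝓕 b → ⁅x, y⁆ ∈ I (a + b)) (h0 : 𝓕 0 ≤ I 0)
    {B : Finset (ZMod n)} (hB : ∀ a ∉ B, 𝓕 a ≤ I a) {d : ℕ} (hd : B.card ≤ d) :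
    derived 𝓕 (kreknin d) ≤ I := by
  have hle : kreknin (B.filter fun a => a.val ≤ n).card ≤ kreknin d :=
    Nat.sub_le_sub_right (Nat.pow_le_pow_right two_pos
      ((Finset.card_le_card (Finset.filter_subset _ _)).trans hd)) 1
  refine (h𝓕.derived_antitone hle).trans ((derived_le_gen_lettersAbove hI h0 B hB n 𝓕 le_rfl
    h𝓕).trans (le_trans (b := fun a => 𝓕 a ⊓ I a) (gen_le ?_ ?_) fun a => inf_le_right))
  · intro b
    simp [lettersAbove, (ZMod.val_lt b).le.not_gt]
  · exact fun a b x y hx hy => ⟨h𝓕 hx.1 hy.1, hI a b x y hx hy.1⟩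

end Kreknin

end LieFamily

/-! ### Products of subspaces which commute modulo an ideal -/

namespace LieFamily

section Pow

variable {K E : Type*} [Field K] [Ring E] [Algebra K E]

lemma pow_le_of_le {X Q : Submodule K E} (hQ : Q * X ≤ Q) {k l : ℕ} (hk : X ^ k ≤ Q)
    (hkl : k ≤ l) : X ^ l ≤ Q := by
  induction l, hkl using Nat.le_induction with
  | base => exact hk
  | succ l _ ih => rw [pow_succ]; exact (mul_le_mul_left ih X).trans hQ

/-- If `X` and `Y` commute modulo `W` and have powers in `W`, so has `X ⊔ Y`: modulo `W`, a product
of factors `X` and `Y` can be sorted into the form `X ^ i * Y ^ j`. -/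
lemma sup_pow_le {X Y W : Submodule K E} (hXW : X * W ≤ W) (hWX : W * X ≤ W) (hYW : Y * W ≤ W)
    (hWY : W * Y ≤ W) (hc : Y * X ≤ X * Y ⊔ W) {p q : ℕ} (hp : X ^ p ≤ W) (hq : Y ^ q ≤ W) :
    (X ⊔ Y) ^ (p + q) ≤ W := by
  have hXi : ∀ i, X ^ i * W ≤ W := fun i => by
    induction i with
    | zero => simp
    | succ i ih => rw [pow_succ, mul_assoc]; exact (mul_le_mul_right hXW _).trans ih
  have hWs : ∀ k, W * (X ⊔ Y) ^ k ≤ W := fun k => by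
    induction k with
    | zero => simp
    | succ k ih =>
      rw [pow_succ, ← mul_assoc]
      refine (mul_le_mul_left ih _).trans ?_
      rw [Submodule.mul_sup]
      exact sup_le hWX hWY
  have hYj : ∀ j, Y ^ j * X ≤ X * Y ^ j ⊔ W := fun j => by
    induction j with
    | zero => simp
    | succ j ih =>
      calc Y ^ (j + 1) * X = Y * (Y ^ j * X) := by rw [pow_succ', mul_assoc]
        _ ≤ Y * (X * Y ^ j ⊔ W) := mul_le_mul_right ih _
        _ = (Y * X) * Y ^ j ⊔ Y * W := by rw [Submodule.mul_sup, mul_assoc]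
        _ ≤ (X * Y ⊔ W) * Y ^ j ⊔ W := sup_le_sup (mul_le_mul_left hc _) hYW
        _ ≤ X * Y ^ (j + 1) ⊔ W := by
          rw [Submodule.sup_mul, mul_assoc, ← pow_succ']
          refine sup_le (sup_le le_sup_left (le_sup_of_le_right ?_)) le_sup_right
          exact (mul_le_mul_right (pow_le_pow_left' le_sup_right j) W).trans (hWs j)
  have key : ∀ k i j, p + q ≤ i + j + k → X ^ i * Y ^ j * (X ⊔ Y) ^ k ≤ W := by
    intro k
    induction k with
    | zero =>
      intro i j h
      rw [pow_zero, mul_one]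
      by_cases hi : p ≤ i
      · refine (mul_le_mul_left (pow_le_of_le hWX hp hi) _).trans ?_
        exact (mul_le_mul_right (pow_le_pow_left' le_sup_right j) W).trans (hWs j)
      · exact (mul_le_mul_right (pow_le_of_le hWY hq (by omega)) _).trans (hXi i)
    | succ k ih =>
      intro i j h
      rw [pow_succ', ← mul_assoc, Submodule.mul_sup, Submodule.sup_mul]
      refine sup_le ?_ ?_
      · calc X ^ i * Y ^ j * X * (X ⊔ Y) ^ k = X ^ i * (Y ^ j * X) * (X ⊔ Y) ^ k := by
              rw [mul_assoc (X ^ i)]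
          _ ≤ X ^ i * (X * Y ^ j ⊔ W) * (X ⊔ Y) ^ k :=
              mul_le_mul_left (mul_le_mul_right (hYj j) _) _
          _ = X ^ (i + 1) * Y ^ j * (X ⊔ Y) ^ k ⊔ X ^ i * W * (X ⊔ Y) ^ k := by
              rw [Submodule.mul_sup, Submodule.sup_mul, pow_succ, mul_assoc (X ^ i) X]
          _ ≤ W := sup_le (ih _ _ (by omega)) ((mul_le_mul_left (hXi i) _).trans (hWs k))
      · rw [mul_assoc (X ^ i), ← pow_succ]
        exact ih _ _ (by omega)
  simpa using key (p + q) 0 0 (by omega)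

/-- Subspaces `J_a` of an associative algebra which commute modulo an invariant subspace `I`, all
but `d` of which lie in an ideal `Q`. If the power of order `m` of each `J_a` lies in `Q`, and some
power of `I` does, then so does some power of their sum, with an exponent depending only on `d`,
`m` and the exponent of `I`. -/
lemma iSup_pow_le {ι : Type*} [DecidableEq ι] {J : ι → Submodule K E} {I Q : Submodule K E}
    (hIJ : I ≤ ⨆ a, J a) (hc : ∀ a b, J a * J b ≤ J b * J a ⊔ I)
    (hJI : ∀ a, J a * I ≤ I * J a ⊔ I) (hJQ : ∀ a, J a * Q ≤ Q) (hQJ : ∀ a, Q * J a ≤ Q)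
    (hQQ : Q * Q ≤ Q) {m : ℕ} (hm : ∀ a, J a ^ m ≤ Q) {B : Finset ι} (hB : ∀ a ∉ B, J a ≤ Q) {d : ℕ}
    (hd : B.card ≤ d) {N : ℕ} (hN : I ^ N ≤ Q) :
    (⨆ a, J a) ^ ((1 + (d * m + 1)) * N) ≤ Q := by
  set S := ⨆ a, J a with hS
  set U : Submodule K E := Subalgebra.toSubmodule (Algebra.adjoin K (S : Set E)) with hU
  have hSU : S ≤ U := fun x hx => Algebra.subset_adjoin hx
  have hJU : ∀ a, J a ≤ U := fun a => (le_iSup J a).trans hSU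
  have h1U : 1 ≤ U := by
    rw [Submodule.one_le]
    exact one_mem (Algebra.adjoin K (S : Set E))
  have hUU : U * U ≤ U := Submodule.mul_le.2 fun x hx y hy =>
    mul_mem (S := Subalgebra K E) hx hy
  have hIU : I ≤ U := hIJ.trans hSU
  have hleU : ∀ P : Submodule K E, P ≤ P * U := fun P => by
    simpa using mul_le_mul_right h1U P
  -- A subspace stable under multiplication by the `J_a` is stable under multiplication by `U`.
  have hstabl : ∀ P : Submodule K E, (∀ a, J a * P ≤ P) → U * P ≤ P := by
    intro P hP
    refine Submodule.mul_le.2 fun x hx => ?_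
    induction hx using Algebra.adjoin_induction with
    | mem x hx =>
      have : S * P ≤ P := by rw [hS, Submodule.iSup_mul]; exact iSup_le hP
      exact fun y hy => this (Submodule.mul_mem_mul hx hy)
    | algebraMap r => intro y hy; rw [← Algebra.smul_def]; exact P.smul_mem _ hy
    | add x y _ _ hx hy => intro z hz; rw [add_mul]; exact add_mem (hx z hz) (hy z hz)
    | mul x y _ _ hx hy => intro z hz; rw [mul_assoc]; exact hx _ (hy z hz)
  have hstabr : ∀ P : Submodule K E, (∀ a, P * J a ≤ P) → P * U ≤ P := by
    intro P hP
    refine Submodule.mul_le.2 fun y hy x hx => ?_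
    induction hx using Algebra.adjoin_induction generalizing y with
    | mem x hx =>
      have : P * S ≤ P := by rw [hS, Submodule.mul_iSup]; exact iSup_le hP
      exact this (Submodule.mul_mem_mul hy hx)
    | algebraMap r => rw [← Algebra.commutes, ← Algebra.smul_def]; exact P.smul_mem _ hy
    | add x z _ _ hx hz => rw [mul_add]; exact add_mem (hx y hy) (hz y hy)
    | mul x z _ _ hx hz => rw [← mul_assoc]; exact hz _ (hx y hy)
  have hUQ : U * Q ≤ Q := hstabl Q hJQ
  have hQU : Q * U ≤ Q := hstabr Q hQJ
  have hUIU : U * (I * U) ≤ I * U := hstabl _ fun a => by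
    rw [← mul_assoc]
    refine (mul_le_mul_left (hJI a) U).trans ?_
    rw [Submodule.sup_mul, mul_assoc]
    exact sup_le (mul_le_mul_right ((mul_le_mul_left (hJU a) U).trans hUU) I) le_rfl
  -- `W` is the ideal of `U` generated by `I` and `Q`. The `J_a` commute modulo `W`, so that a power
  -- of their sum lies in `W`, and `W ^ N` lies in `I ^ N * U ⊔ Q`.
  set W := I * U ⊔ Q with hW
  have hIW : I ≤ W := le_sup_of_le_left (hleU I)
  have hQW : Q ≤ W := le_sup_right
  have hUW : U * W ≤ W := by
    rw [hW, Submodule.mul_sup]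
    exact sup_le_sup hUIU hUQ
  have hWU : W * U ≤ W := by
    rw [hW, Submodule.sup_mul, mul_assoc]
    exact sup_le_sup (mul_le_mul_right hUU I) hQU
  have hPW : ∀ P ≤ U, P * W ≤ W := fun P hP => (mul_le_mul_left hP W).trans hUW
  have hWP : ∀ P ≤ U, W * P ≤ W := fun P hP => (mul_le_mul_right hP W).trans hWU
  have hfin : ∀ s : Finset ι, (⨆ a ∈ s, J a) ^ (s.card * m + 1) ≤ W := by
    intro s
    induction s using Finset.induction_on with
    | empty => simp
    | insert a s ha ih =>
      have hsU : ⨆ b ∈ s, J b ≤ U := iSup₂_le fun b _ => hJU b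
      rw [Finset.iSup_insert, Finset.card_insert_of_notMem ha,
        show (s.card + 1) * m + 1 = m + (s.card * m + 1) by ring]
      refine sup_pow_le (hPW _ (hJU a)) (hWP _ (hJU a)) (hPW _ hsU) (hWP _ hsU) ?_
        ((hm a).trans hQW) ih
      simp only [Submodule.iSup_mul]
      refine iSup₂_le fun b hb => (hc b a).trans (sup_le_sup (mul_le_mul_right ?_ _) hIW)
      exact le_iSup₂_of_le b hb le_rfl
  have hSW : S ^ (1 + (d * m + 1)) ≤ W := by
    have hX : ⨆ a ∉ B, J a ≤ Q := iSup₂_le hB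
    have hXU : ⨆ a ∉ B, J a ≤ U := iSup₂_le fun a _ => hJU a
    have hYU : ⨆ a ∈ B, J a ≤ U := iSup₂_le fun a _ => hJU a
    have hXY : S = (⨆ a ∉ B, J a) ⊔ ⨆ a ∈ B, J a := by
      refine le_antisymm (iSup_le fun a => ?_)
        (sup_le (iSup₂_le fun a _ => le_iSup J a) (iSup₂_le fun a _ => le_iSup J a))
      by_cases ha : a ∈ B
      · exact le_sup_of_le_right (le_iSup₂_of_le a ha le_rfl)
      · exact le_sup_of_le_left (le_iSup₂_of_le a ha le_rfl)
    rw [hXY]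
    refine sup_pow_le (hPW _ hXU) (hWP _ hXU) (hPW _ hYU) (hWP _ hYU) ?_
      (by rw [pow_one]; exact hX.trans hQW)
      (pow_le_of_le (hWP _ hYU) (hfin B) (by gcongr))
    exact le_sup_of_le_right (((mul_le_mul_right (hX.trans hQW) _).trans (hPW _ hYU)))
  have hIkU : ∀ k, I ^ k ≤ U := fun k => by
    induction k with
    | zero => simpa using h1U
    | succ k ih => rw [pow_succ]; exact (mul_le_mul' ih hIU).trans hUU
  have hWk : ∀ k, W ^ k ≤ I ^ k * U ⊔ Q := fun k => by
    induction k with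
    | zero => simpa using le_sup_of_le_left h1U
    | succ k ih =>
      rw [pow_succ]
      refine (mul_le_mul_left ih W).trans ?_
      rw [hW, Submodule.mul_sup, Submodule.sup_mul, Submodule.sup_mul]
      refine sup_le (sup_le (le_sup_of_le_left ?_) (le_sup_of_le_right ?_))
        (le_sup_of_le_right (sup_le ?_ ?_))
      · rw [mul_assoc, pow_succ, mul_assoc (I ^ k) I U]
        exact mul_le_mul_right hUIU _
      · exact (mul_le_mul_right ((mul_le_mul_left hIU U).trans hUU) Q).trans hQU
      · exact (mul_le_mul_left ((mul_le_mul_left (hIkU k) U).trans hUU) Q).trans hUQ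
      · exact hQQ
  rw [pow_mul]
  refine (pow_le_pow_left' hSW N).trans ((hWk N).trans (sup_le ?_ le_rfl))
  exact (mul_le_mul_left hN U).trans hQU

end Pow

end LieFamily

/-! ### The action of a subalgebra of finite cosupport -/

namespace LieFamily

section Action

variable {n : ℕ} {K L : Type*} [Field K] [LieRing L] [LieAlgebra K L]

/-- A set of residues is *coset-free* if it contains no coset of a nontrivial subgroup. It suffices
to consider cyclic subgroups, and for `n ≠ 0` these consist of the multiples `k • δ` with
`k : ℕ`. -/
def CosetFree (F : Finset (ZMod n)) : Prop :=
  ∀ h δ : ZMod n, δ ≠ 0 → ∃ k : ℕ, h + k • δ ∉ F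

lemma CosetFree.mono {F F' : Finset (ZMod n)} (hF : CosetFree F) (h : F' ⊆ F) : CosetFree F' :=
  fun x δ hδ => (hF x δ hδ).imp fun _ hk hk' => hk (h hk')

/-- A progression leaves a coset-free set after at most as many steps as the set has elements:
otherwise it would be periodic with all of its terms in the set. -/
lemma CosetFree.exists_le {F : Finset (ZMod n)} (hF : CosetFree F) (h : ZMod n) {δ : ZMod n}
    (hδ : δ ≠ 0) : ∃ k ≤ F.card, h + k • δ ∉ F := by
  by_contra! hall
  obtain ⟨k, hk, l, hl, hkl, heq⟩ : ∃ k ∈ Finset.range (F.card + 1),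
      ∃ l ∈ Finset.range (F.card + 1), k ≠ l ∧ h + k • δ = h + l • δ :=
    Finset.exists_ne_map_eq_of_card_lt_of_maps_to (t := F) (by simp)
      fun k hk => hall k (by simpa [Nat.lt_succ_iff] using hk)
  wlog hlt : k < l generalizing k l
  · exact this l hl k hk hkl.symm heq.symm (by omega)
  obtain ⟨d, rfl⟩ := Nat.exists_eq_add_of_lt hlt
  have hd : (d + 1) • δ = 0 := by
    have h1 : k • δ = (k + d + 1) • δ := add_left_cancel heq
    rw [add_assoc, add_nsmul] at h1
    simpa using h1
  obtain ⟨r, hr⟩ := hF h δ hδ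
  apply hr
  have : r • δ = (r % (d + 1)) • δ := by
    conv_lhs => rw [← Nat.mod_add_div r (d + 1), add_nsmul, mul_comm, mul_nsmul', hd]
    simp
  rw [this]
  refine hall _ ?_
  have : r % (d + 1) < d + 1 := Nat.mod_lt r (Nat.succ_pos d)
  have := Finset.mem_range.1 hl
  omega

/-- `C` is a graded subalgebra of `𝓕` which contains the components of index outside `F`. -/
structure Cosupported (𝓕 C : ZMod n → Submodule K L) (F : Finset (ZMod n)) : Prop where
  isLie : IsLie 𝓕
  isLie_sub : IsLie C
  le : C ≤ 𝓕
  le_of_notMem : ∀ a ∉ F, 𝓕 a ≤ C a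

/-- The image of a homogeneous component in the endomorphism algebra, under the adjoint
representation. -/
def adFamily (C : ZMod n → Submodule K L) (a : ZMod n) : Submodule K (Module.End K L) :=
  (C a).map (LieAlgebra.ad K L : L →ₗ[K] Module.End K L)

/-- The endomorphisms which carry all components of `𝓕` into the sum of the components of `C`. -/
def intoSub (𝓕 C : ZMod n → Submodule K L) : Submodule K (Module.End K L) where
  carrier := {T | ∀ x ∈ ⨆ a, 𝓕 a, T x ∈ ⨆ a, C a}
  zero_mem' _ _ := zero_mem _
  add_mem' h h' x hx := add_mem (h x hx) (h' x hx)
  smul_mem' k _ h x hx := Submodule.smul_mem _ k (h x hx)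

variable {𝓕 C : ZMod n → Submodule K L} {F : Finset (ZMod n)}

lemma mem_intoSub {T : Module.End K L} (h : ∀ a, ∀ x ∈ 𝓕 a, T x ∈ ⨆ a, C a) :
    T ∈ intoSub 𝓕 C := by
  intro x hx
  have : ⨆ a, 𝓕 a ≤ (⨆ a, C a).comap T := iSup_le fun a x hx => h a x hx
  exact this hx

lemma ad_mem_adFamily {a : ZMod n} {c : L} (hc : c ∈ C a) : LieAlgebra.ad K L c ∈ adFamily C a :=
  ⟨c, hc, rfl⟩

lemma adFamily_mono {C' : ZMod n → Submodule K L} (h : C' ≤ C) (a : ZMod n) :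
    adFamily C' a ≤ adFamily C a := Submodule.map_mono (h a)

lemma lie_mem_iSup {𝓖 : ZMod n → Submodule K L} {a : ZMod n} {c x : L}
    (h : ∀ b, ∀ y ∈ 𝓖 b, ⁅c, y⁆ ∈ 𝓖 (a + b)) (hx : x ∈ ⨆ b, 𝓖 b) : ⁅c, x⁆ ∈ ⨆ b, 𝓖 b := by
  have : ⨆ b, 𝓖 b ≤ (⨆ b, 𝓖 b).comap (LieAlgebra.ad K L c) :=
    iSup_le fun b y hy => (le_iSup 𝓖 (a + b)) (h b y hy)
  exact this hx

lemma adFamily_comm {𝓖 𝓖' 𝓗 : ZMod n → Submodule K L}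
    (h : ∀ a b x y, x ∈ 𝓖 a → y ∈ 𝓖' b → ⁅x, y⁆ ∈ 𝓗 (a + b)) (a b : ZMod n) :
    adFamily 𝓖 a * adFamily 𝓖' b ≤ adFamily 𝓖' b * adFamily 𝓖 a ⊔ ⨆ c, adFamily 𝓗 c := by
  refine Submodule.mul_le.2 ?_
  rintro _ ⟨x, hx, rfl⟩ _ ⟨y, hy, rfl⟩
  have : (LieAlgebra.ad K L x) * (LieAlgebra.ad K L y) =
      (LieAlgebra.ad K L y) * (LieAlgebra.ad K L x) + LieAlgebra.ad K L ⁅x, y⁆ := by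
    ext z
    simp
  change LieAlgebra.ad K L x * LieAlgebra.ad K L y ∈ _
  rw [this]
  exact Submodule.add_mem_sup (Submodule.mul_mem_mul (ad_mem_adFamily hy) (ad_mem_adFamily hx))
    (le_iSup (adFamily 𝓗) (a + b) (ad_mem_adFamily (h _ _ _ _ hx hy)))

namespace Cosupported

variable (H : Cosupported 𝓕 C F)
include H

lemma adFamily_mul_le (a : ZMod n) : adFamily C a * intoSub 𝓕 C ≤ intoSub 𝓕 C := by
  refine Submodule.mul_le.2 ?_
  rintro _ ⟨c, hc, rfl⟩ T hT x hx
  exact lie_mem_iSup (fun b y hy => H.isLie_sub hc hy) (hT x hx)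

lemma mul_adFamily_le (a : ZMod n) : intoSub 𝓕 C * adFamily C a ≤ intoSub 𝓕 C := by
  refine Submodule.mul_le.2 ?_
  rintro T hT _ ⟨c, hc, rfl⟩ x hx
  exact hT _ (lie_mem_iSup (fun b y hy => H.isLie (H.le _ hc) hy) hx)

lemma intoSub_mul_le : intoSub 𝓕 C * intoSub 𝓕 C ≤ intoSub 𝓕 C := by
  refine Submodule.mul_le.2 fun T hT T' hT' x hx => hT _ ?_
  exact iSup_mono H.le (hT' x hx)

/-- Once a product `[c_k, …, [c_1, x]]` of elements `c_i ∈ C_a` with `x ∈ 𝓕_h` reaches an index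
outside of `F`, it stays in `C`. -/
lemma adFamily_pow_apply {a : ZMod n} (k : ℕ) : ∀ T ∈ adFamily C a ^ k, ∀ h, ∀ x ∈ 𝓕 h,
    T x ∈ 𝓕 (h + k • a) ∧ ((∃ l ≤ k, h + l • a ∉ F) → T x ∈ C (h + k • a)) := by
  induction k with
  | zero =>
    intro T hT h x hx
    rw [pow_zero, Submodule.mem_one] at hT
    obtain ⟨r, rfl⟩ := hT
    simp only [zero_smul, add_zero, Module.algebraMap_end_apply, nonpos_iff_eq_zero, exists_eq_left]
    exact ⟨Submodule.smul_mem _ _ hx, fun h' => Submodule.smul_mem _ _ (H.le_of_notMem _ h' hx)⟩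
  | succ k ih =>
    intro T hT h x hx
    have hadd : h + (k + 1) • a = a + (h + k • a) := by rw [succ_nsmul]; abel
    rw [pow_succ'] at hT
    induction hT using Submodule.mul_induction_on' with
    | mem_mul_mem r hr T hT =>
      obtain ⟨c, hc, rfl⟩ := hr
      obtain ⟨h1, h2⟩ := ih T hT h x hx
      have h3 : ⁅c, T x⁆ ∈ 𝓕 (h + (k + 1) • a) := hadd ▸ H.isLie (H.le _ hc) h1
      refine ⟨h3, fun ⟨l, hl, hlF⟩ => ?_⟩
      rcases Nat.lt_or_ge k l with hkl | hkl
      · obtain rfl : l = k + 1 := by omega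
        exact H.le_of_notMem _ hlF h3
      · exact hadd ▸ H.isLie_sub hc (h2 ⟨l, hkl, hlF⟩)
    | add T _ T' _ hT hT' =>
      exact ⟨add_mem hT.1 hT'.1, fun h' => add_mem (hT.2 h') (hT'.2 h')⟩

/-- The components of `C` act nilpotently on the quotient of `𝓕` by `C`, since the progression
`h, h + a, h + 2a, …` leaves `F`. -/
lemma adFamily_pow_le (hF : CosetFree F) (h0 : 𝓕 0 = ⊥) (a : ZMod n) :
    adFamily C a ^ (F.card + 1) ≤ intoSub 𝓕 C := by
  rcases eq_or_ne a 0 with rfl | ha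
  · have : adFamily C 0 = ⊥ := by
      rw [adFamily, show C 0 = ⊥ from le_bot_iff.1 (h0 ▸ H.le 0), Submodule.map_bot]
    rw [this, ← Submodule.zero_eq_bot, zero_pow (Nat.succ_ne_zero _)]
    exact bot_le
  · refine fun T hT => mem_intoSub fun h x hx => ?_
    obtain ⟨l, hl, hlF⟩ := hF.exists_le h ha
    exact (le_iSup C _) ((H.adFamily_pow_apply _ T hT h x hx).2 ⟨l, by omega, hlF⟩)

open scoped Pointwise in
/-- Elements of index outside of `F - F` act trivially on the quotient of `𝓕` by `C`, as they shift
all indices from `F` out of `F`. -/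
lemma lie_mem_of_notMem_sub {a b : ZMod n} (ha : a ∉ F - F) {c x : L} (hc : c ∈ C a)
    (hx : x ∈ 𝓕 b) : ⁅c, x⁆ ∈ C (a + b) := by
  by_cases hb : b ∈ F
  · refine H.le_of_notMem _ (fun h => ha ?_) (H.isLie (H.le _ hc) hx)
    exact Finset.mem_sub.2 ⟨_, h, b, hb, by abel⟩
  · exact H.isLie_sub hc (H.le_of_notMem _ hb hx)

/-- By Kreknin's theorem, applied modulo the kernel of the action on the quotient, a term of the
derived series of `C` acts trivially on the quotient of `𝓕` by `C`. -/
lemma adFamily_derived_le [NeZero n] (h0 : 𝓕 0 = ⊥) {m : ℕ} (hm : F.card ≤ m) (a : ZMod n) :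
    adFamily (derived C (kreknin (m * m))) a ≤ intoSub 𝓕 C := by
  classical
  open scoped Pointwise in
  let I : ZMod n → Submodule K L := fun a =>
    { carrier := {c | ∀ b, ∀ x ∈ 𝓕 b, ⁅c, x⁆ ∈ C (a + b)}
      zero_mem' := fun b x _ => by simp
      add_mem' := fun h h' b x hx => by rw [add_lie]; exact add_mem (h b x hx) (h' b x hx)
      smul_mem' := fun k c h b x hx => by
        rw [smul_lie]; exact Submodule.smul_mem _ _ (h b x hx) }
  have hI : derived C (kreknin (m * m)) ≤ I := by
    refine derived_kreknin_le H.isLie_sub ?_ ?_ (B := F - F) ?_ ?_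
    · intro a b c d hc hd e x hx
      rw [lie_lie, add_assoc]
      refine sub_mem (hc.2 _ _ (H.isLie (H.le _ hd) hx)) ?_
      rw [add_left_comm]
      exact H.isLie_sub hd (hc.2 _ _ hx)
    · intro c hc
      rw [show C 0 = ⊥ from le_bot_iff.1 (h0 ▸ H.le 0), Submodule.mem_bot] at hc
      subst hc
      exact zero_mem _
    · exact fun a ha c hc b x hx => H.lie_mem_of_notMem_sub ha hc hx
    · exact Finset.card_sub_le.trans (Nat.mul_le_mul hm hm)
  rintro _ ⟨c, hc, rfl⟩
  exact mem_intoSub fun b x hx => le_iSup C (a + b) (hI a hc b x hx)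

end Cosupported

/-- A bound for the nilpotency index of the action of a subalgebra of cosupport of order `m`. -/
def nilpotencyBound (m : ℕ) : ℕ :=
  (1 + (m * m * (m + 1) + 1)) ^ kreknin (m * m)

open scoped Pointwise in
/-- If the cosupport is coset-free, then products of homogeneous elements of `C` of bounded length
act trivially on the quotient of `𝓕` by `C`: elements of one component act nilpotently, and the
terms of the derived series of `C` are treated one after the other, starting with the last one. -/
theorem Cosupported.iSup_adFamily_pow_le [NeZero n] (H : Cosupported 𝓕 C F) (hF : CosetFree F)
    (h0 : 𝓕 0 = ⊥) {m : ℕ} (hm : F.card ≤ m) :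
    (⨆ a, adFamily C a) ^ nilpotencyBound m ≤ intoSub 𝓕 C := by
  have key : ∀ k t, t + k = kreknin (m * m) →
      (⨆ a, adFamily (derived C t) a) ^ (1 + (m * m * (m + 1) + 1)) ^ k ≤ intoSub 𝓕 C := by
    intro k
    induction k with
    | zero =>
      rintro t rfl
      rw [pow_zero, pow_one]
      exact iSup_le fun a => H.adFamily_derived_le h0 hm a
    | succ k ih =>
      intro t ht
      have hL := H.isLie_sub.derived t
      have hle : adFamily (derived C t) ≤ adFamily C := adFamily_mono (H.isLie_sub.derived_le t)
      have hD : derived C (t + 1) ≤ derived C t := H.isLie_sub.derived_antitone (Nat.le_succ t)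
      rw [pow_succ']
      refine iSup_pow_le (I := ⨆ a, adFamily (derived C (t + 1)) a) (iSup_mono (adFamily_mono hD))
        (adFamily_comm fun a b x y hx hy => ?_) (fun a => ?_)
        (fun a => (mul_le_mul_left (hle a) _).trans (H.adFamily_mul_le a))
        (fun a => (mul_le_mul_right (hle a) _).trans (H.mul_adFamily_le a)) H.intoSub_mul_le
        (fun a => (pow_le_pow_left' (hle a) _).trans (pow_le_of_le (H.mul_adFamily_le a)
          (H.adFamily_pow_le hF h0 a) (Nat.succ_le_succ hm)))
        (B := F - F) (fun a ha => (hle a).trans ?_)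
        (Finset.card_sub_le.trans (Nat.mul_le_mul hm hm)) (ih (t + 1) (by omega))
      · rw [derived_succ]
        exact lie_mem_bracket hx hy rfl
      · rw [Submodule.mul_iSup, Submodule.iSup_mul]
        refine iSup_le fun b => (adFamily_comm (𝓗 := derived C (t + 1)) ?_ a b).trans
          (sup_le_sup_right (le_iSup (fun b => adFamily (derived C (t + 1)) b * _) b) _)
        intro a b x y hx hy
        rw [derived_succ]
        exact lie_mem_bracket hx (hD _ hy) rfl
      · rintro _ ⟨c, hc, rfl⟩
        exact mem_intoSub fun b x hx => le_iSup C (a + b) (H.lie_mem_of_notMem_sub ha hc hx)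
  exact key _ 0 (zero_add _)

end Action

end LieFamily

/-! ### Subalgebras of coset-free cosupport contain a term of the derived series -/

namespace LieFamily

section Elimination

variable {n : ℕ} {K L : Type*} [Field K] [LieRing L] [LieAlgebra K L]

/-- The descending series `C + [… [[𝓕, C], C] …, C]` of families between `𝓕` and `C`, with `r`
factors `C`. -/
def actionSeries (𝓕 C : ZMod n → Submodule K L) : ℕ → ZMod n → Submodule K L
  | 0 => 𝓕
  | r + 1 => C ⊔ bracket (actionSeries 𝓕 C r) C

variable {𝓕 C 𝓛 : ZMod n → Submodule K L} {F : Finset (ZMod n)}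

lemma iSup_inf_le_of_iSupIndep (h𝓛 : iSupIndep 𝓛) (hC : C ≤ 𝓛) (a : ZMod n) :
    (⨆ b, C b) ⊓ 𝓛 a ≤ C a := by
  have h1 : ⨆ b, C b ≤ C a ⊔ ⨆ b, ⨆ (_ : b ≠ a), 𝓛 b := by
    refine iSup_le fun b => ?_
    rcases eq_or_ne b a with rfl | hb
    · exact le_sup_left
    · exact (hC b).trans (le_sup_of_le_right (le_iSup₂_of_le b hb le_rfl))
  refine (inf_le_inf_right _ h1).trans ?_
  rw [sup_inf_assoc_of_le _ (hC a), (h𝓛 a).symm.eq_bot, sup_bot_eq]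

namespace Cosupported

variable (H : Cosupported 𝓕 C F)
include H

lemma iSup_adFamily_pow_le_intoSub_self (k : ℕ) : (⨆ a, adFamily C a) ^ k ≤ intoSub C C := by
  induction k with
  | zero =>
    rw [pow_zero]
    rintro _ hT
    obtain ⟨r, rfl⟩ := Submodule.mem_one.1 hT
    exact fun x hx => Submodule.smul_mem _ r hx
  | succ k ih =>
    rw [pow_succ, Submodule.mul_iSup]
    refine iSup_le fun a => Submodule.mul_le.2 ?_
    rintro T hT _ ⟨c, hc, rfl⟩ x hx
    exact ih hT _ (lie_mem_iSup (fun b y hy => H.isLie_sub hc hy) hx)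

/-- By induction on `r`: as `T [y, c] = -(T ∘ ad c) y`, a factor `C` in the action series can be
traded for a factor of the endomorphism. -/
lemma pow_apply_mem_of_mem_actionSeries {N : ℕ} (hN : (⨆ a, adFamily C a) ^ N ≤ intoSub 𝓕 C)
    (r : ℕ) : ∀ k, r + k = N → ∀ T ∈ (⨆ a, adFamily C a) ^ k, ∀ a, ∀ x ∈ actionSeries 𝓕 C r a,
      T x ∈ ⨆ a, C a := by
  induction r with
  | zero =>
    rintro k hk T hT a x hx
    obtain rfl : k = N := by omega
    exact hN hT x (le_iSup 𝓕 a hx)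
  | succ r ih =>
    rintro k hk T hT a x hx
    refine (?_ : actionSeries 𝓕 C (r + 1) a ≤ (⨆ a, C a).comap T) hx
    refine sup_le (fun y hy => ?_) (bracket_le fun b c _ y hy z hz => ?_)
    · exact H.iSup_adFamily_pow_le_intoSub_self k hT y (le_iSup C a hy)
    · have hmem : T * LieAlgebra.ad K L z ∈ (⨆ a, adFamily C a) ^ (k + 1) := by
        rw [pow_succ]
        exact Submodule.mul_mem_mul hT (le_iSup (adFamily C) c (ad_mem_adFamily hz))
      have := ih (k + 1) (by omega) _ hmem b y hy
      rw [Submodule.mem_comap, ← lie_skew, map_neg]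
      exact neg_mem this

lemma actionSeries_le {N : ℕ} (hN : (⨆ a, adFamily C a) ^ N ≤ intoSub 𝓕 C)
    (h𝓛 : iSupIndep 𝓛) (h : 𝓕 ≤ 𝓛) : actionSeries 𝓕 C N ≤ C := by
  have hle : ∀ r, actionSeries 𝓕 C r ≤ 𝓕 := by
    intro r
    induction r with
    | zero => exact le_rfl
    | succ r ih => exact sup_le H.le ((bracket_mono ih H.le).trans H.isLie.bracket_le_self)
  refine fun a x hx => iSup_inf_le_of_iSupIndep h𝓛 (H.le.trans h) a ⟨?_, h _ (hle N _ hx)⟩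
  exact H.pow_apply_mem_of_mem_actionSeries hN N 0 rfl 1
    (by rw [pow_zero]; exact Submodule.mem_one.2 ⟨1, map_one _⟩) a x hx

/-- Adjoining one full component to a cosupported subalgebra removes its index from the
cosupport. -/
lemma gen_update (f : ZMod n) :
    Cosupported 𝓕 (gen (Function.update C f (𝓕 f))) (F.erase f) where
  isLie := H.isLie
  isLie_sub := isLie_gen
  le := gen_le (update_le_iff.2 ⟨le_rfl, fun a _ => H.le a⟩) H.isLie
  le_of_notMem a ha := by
    refine le_trans ?_ (le_gen a)
    rcases eq_or_ne a f with rfl | haf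
    · simp
    · rw [Function.update_of_ne haf]
      exact H.le_of_notMem a fun h => ha (Finset.mem_erase.2 ⟨haf, h⟩)

/-- In a word of index `f` of length at least two, with letters from `𝓕_f` and `C`, the last letter
comes from `C`, because otherwise the rest of the word has index zero. -/
lemma derived_succ_le (h0 : 𝓕 0 = ⊥) {g : ℕ}
    (hg : ∀ f ∈ F, derived 𝓕 g ≤ gen (Function.update C f (𝓕 f))) :
    derived 𝓕 (g + 1) ≤ C ⊔ bracket 𝓕 C := by
  intro f
  by_cases hf : f ∈ F
  · refine le_trans ?_ (le_sup_right : bracket 𝓕 C f ≤ _)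
    have hgen := (H.gen_update f).le
    rw [derived_succ]
    refine bracket_le fun b c hbc x hx y hy => ?_
    have hxy := lie_mem_bracket_gen (hg f hf _ hx) (hg f hf _ hy)
    rw [hbc] at hxy
    refine (?_ : bracket (gen (Function.update C f (𝓕 f))) (Function.update C f (𝓕 f)) f ≤ _) hxy
    refine bracket_le fun b c hbc x hx y hy => ?_
    rcases eq_or_ne c f with rfl | hcf
    · obtain rfl : b = 0 := by simpa using hbc
      have hx0 := hgen _ hx
      rw [h0, Submodule.mem_bot] at hx0
      rw [hx0, zero_lie]
      exact zero_mem _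
    · rw [Function.update_of_ne hcf] at hy
      exact lie_mem_bracket (hgen _ hx) hy hbc
  · exact (H.isLie.derived_le _ f).trans ((H.le_of_notMem f hf).trans le_sup_left)

lemma restrict {𝓖 : ZMod n → Submodule K L} (h𝓖 : IsLie 𝓖) (h : 𝓖 ≤ 𝓕) :
    Cosupported 𝓖 (C ⊓ 𝓖) F where
  isLie := h𝓖
  isLie_sub _ _ _ _ hx hy := ⟨H.isLie_sub hx.1 hy.1, h𝓖 hx.2 hy.2⟩
  le := inf_le_right
  le_of_notMem a ha := le_inf ((h a).trans (H.le_of_notMem a ha)) le_rfl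

end Cosupported

/-- The level of the derived series which lies in every subalgebra of coset-free cosupport of order
at most `m`. -/
def eliminationDepth : ℕ → ℕ
  | 0 => 0
  | m + 1 => nilpotencyBound (m + 1) * (eliminationDepth m + 1)

/-- If `𝓕_0 = 0`, then a subalgebra which contains all components of `𝓕` with indices outside of a
coset-free set of order `m` contains a term of the derived series whose level is bounded in terms of
`m`. By induction on `m`, every `r` steps of the derived series lead from a term of the action
series to the next one, and the action series reaches `C` because the action of `C` on the quotient
is nilpotent. -/
theorem Cosupported.derived_le [NeZero n] (h𝓛 : iSupIndep 𝓛) (m : ℕ) :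
    ∀ {𝓕 C : ZMod n → Submodule K L} {F : Finset (ZMod n)}, Cosupported 𝓕 C F → CosetFree F →
      𝓕 ≤ 𝓛 → 𝓕 0 = ⊥ → F.card ≤ m → derived 𝓕 (eliminationDepth m) ≤ C := by
  induction m with
  | zero =>
    intro 𝓕 C F H _ _ _ hm a
    obtain rfl : F = ∅ := by simpa using hm
    exact H.le_of_notMem a (by simp)
  | succ m ih =>
    intro 𝓕 C F H hF h h0 hm
    set g := eliminationDepth m
    have hstep : ∀ r, derived 𝓕 (r * (g + 1)) ≤ actionSeries 𝓕 C r := by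
      intro r
      induction r with
      | zero => rw [zero_mul]; exact le_rfl
      | succ r ihr =>
        rw [add_mul, one_mul, add_comm, derived_add]
        set 𝓖 := derived 𝓕 (r * (g + 1))
        have h𝓖 : 𝓖 ≤ 𝓕 := H.isLie.derived_le _
        have H' := H.restrict (H.isLie.derived (r * (g + 1))) h𝓖
        have h0' : 𝓖 0 = ⊥ := le_bot_iff.1 (h0 ▸ h𝓖 0)
        refine (H'.derived_succ_le h0' fun f hf => ?_).trans
          (sup_le_sup inf_le_left (bracket_mono ihr inf_le_left))
        refine ih (H'.gen_update f) (hF.mono (Finset.erase_subset _ _)) (h𝓖.trans h) h0' ?_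
        rw [Finset.card_erase_of_mem hf]
        omega
    exact (hstep _).trans (H.actionSeries_le (H.iSup_adFamily_pow_le hF h0 hm) h𝓛 h)

/-- If all products `[𝓛_a, 𝓛_{i-a}]` lie in a subspace `Y`, except for indices `a` from a coset-free
set `F`, then the component of index `i` of some term of the derived series lies in `Y`. Indeed, the
elements of `𝓛_a` which are mapped into `Y` by `𝓛_{i-a}` form a subalgebra. -/
theorem derived_apply_le [NeZero n] (h𝓛 : IsLie 𝓛) (hind : iSupIndep 𝓛) (h0 : 𝓛 0 = ⊥)
    {F : Finset (ZMod n)} (hF : CosetFree F) {m : ℕ} (hm : F.card ≤ m) {i : ZMod n}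
    {Y : Submodule K L} (hY : ∀ a ∉ F, ∀ x ∈ 𝓛 a, ∀ z ∈ 𝓛 (i - a), ⁅x, z⁆ ∈ Y) :
    derived 𝓛 (eliminationDepth m + 1) i ≤ Y := by
  let C : ZMod n → Submodule K L := fun a =>
    { carrier := {x | x ∈ 𝓛 a ∧ ∀ z ∈ 𝓛 (i - a), ⁅x, z⁆ ∈ Y}
      zero_mem' := ⟨zero_mem _, fun z _ => by simp⟩
      add_mem' := fun h h' => ⟨add_mem h.1 h'.1, fun z hz => by
        rw [add_lie]; exact add_mem (h.2 z hz) (h'.2 z hz)⟩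
      smul_mem' := fun k c h => ⟨Submodule.smul_mem _ _ h.1, fun z hz => by
        rw [smul_lie]; exact Submodule.smul_mem _ _ (h.2 z hz)⟩ }
  have H : Cosupported 𝓛 C F :=
    { isLie := h𝓛
      isLie_sub := fun a b x y hx hy => ⟨h𝓛 hx.1 hy.1, fun z hz => by
        rw [lie_lie]
        refine sub_mem (hx.2 _ ?_) (hy.2 _ ?_)
        · rw [show i - a = b + (i - (a + b)) by abel]
          exact h𝓛 hy.1 hz
        · rw [show i - b = a + (i - (a + b)) by abel]
          exact h𝓛 hx.1 hz⟩
      le := fun a x hx => hx.1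
      le_of_notMem := fun a ha x hx => ⟨hx, hY a ha x hx⟩ }
  rw [derived_succ]
  refine bracket_le fun b c hbc x hx y hy => ?_
  refine (Cosupported.derived_le hind m H hF le_rfl h0 hm _ hx).2 y ?_
  rw [show i - b = c by rw [← hbc]; abel]
  exact h𝓛.derived_le _ _ hy

end Elimination

end LieFamily

/-! ### Coset-free sets of residues modulo an odd number -/

namespace LieFamily

section Residues

variable {n : ℕ}

lemma eq_zero_of_add_self (hn : Odd n) {x : ZMod n} (h : x + x = 0) : x = 0 := by
  obtain ⟨m, rfl⟩ := hn
  have h1 : ((2 * m + 1 : ℕ) : ZMod (2 * m + 1)) = 0 := ZMod.natCast_self _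
  push_cast at h1
  linear_combination x * h1 - m * h

/-- The order of the subgroup `J` divides three if `J` has a coset with at most four elements. -/
lemma three_mul_eq_zero (hn : Odd n) {J : AddSubgroup (ZMod n)} {h : ZMod n} {T : Finset (ZMod n)}
    (hT : T.card ≤ 4) (hJ : ∀ g ∈ J, h + g ∈ T) {g : ZMod n} (hg : g ∈ J) : 3 * g = 0 := by
  obtain ⟨k, hk, l, hl, hkl, heq⟩ : ∃ k ∈ Finset.range 5, ∃ l ∈ Finset.range 5,
      k ≠ l ∧ h + k • g = h + l • g :=
    Finset.exists_ne_map_eq_of_card_lt_of_maps_to (t := T) (by simpa using by omega)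
      fun k _ => hJ _ (nsmul_mem hg k)
  have h0 := eq_zero_of_add_self hn (x := g)
  have h1 := eq_zero_of_add_self hn (x := g + g)
  have h2 : (k : ZMod n) * g = l * g := by simpa using heq
  rw [Finset.mem_range] at hk hl
  interval_cases k <;> interval_cases l <;> simp at hkl h2 <;> grind

lemma cosetFree_pair (hn : Odd n) (a b : ZMod n) : CosetFree {a, b} := by
  intro h δ hδ
  by_contra! hall
  have h0 := eq_zero_of_add_self hn (x := δ)
  have h1 := hall 0
  have h2 := hall 1
  have h3 := hall 2
  simp only [Finset.mem_insert, Finset.mem_singleton, zero_smul, add_zero, one_smul,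
    two_nsmul] at h1 h2 h3
  grind

/-- The residues `a` for which `a` or `i - a` is the negative of one of the sums `p`, `q`, `p + q`
over the nonempty subsequences of `(p, q)`. -/
def exceptional (i p q : ZMod n) : Finset (ZMod n) :=
  {-p, -q, -(p + q), i + p, i + q, i + (p + q)}

lemma mem_exceptional {i p q a : ZMod n} : a ∈ exceptional i p q ↔
    a = -p ∨ a = -q ∨ a = -(p + q) ∨ a = i + p ∨ a = i + q ∨ a = i + (p + q) := by
  simp [exceptional]

lemma exceptional_comm (i p q : ZMod n) : exceptional i p q = exceptional i q p := by
  ext a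
  simp only [mem_exceptional, add_comm p q]
  tauto

lemma card_exceptional_le (i p q : ZMod n) : (exceptional i p q).card ≤ 6 := Finset.card_le_six

lemma sub_mem_exceptional {i p q a : ZMod n} (h : a ∈ exceptional i p q) :
    i - a ∈ exceptional i p q := by
  simp only [mem_exceptional] at h ⊢
  grind

/-- For odd `n`, this relation between `i` and `j` holds whenever `exceptional i p q`, with
`p + q = j`, omits `0` and contains a coset of a nontrivial subgroup. -/
def Related (i j : ZMod n) : Prop :=
  3 * (i + j) = 0 ∨ 2 * i + 3 * j = 0 ∨ 3 * i + 6 * j = 0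

lemma Related.mul_eq_zero (hn : Odd n) {i j : ZMod n} (h : Related i j) (h' : Related j i) :
    45 * (i + j) = 0 := by
  have h1 := eq_zero_of_add_self hn (x := 3 * (i + j))
  have h2 := eq_zero_of_add_self hn (x := 6 * (i + j))
  unfold Related at h h'
  grind

section Coset

variable {i p q : ZMod n} {J : AddSubgroup (ZMod n)}

/-- The case that `-p` and `-(p + q)` lie in a coset contained in the exceptional set. The coset
contains neither `0` nor `i`, which excludes `-q` and `i + q` from it. -/
lemma related_of_mem (hn : Odd n) (h0 : 0 ∉ exceptional i p q)
    (hJ : ∀ g ∈ J, -p + g ∈ exceptional i p q) (hq : q ∈ J) : Related i (p + q) := by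
  have hp : p ∉ J := fun h => h0 (by simpa using hJ _ h)
  have hip : i + p ∉ J := fun h => h0 (by simpa using sub_mem_exceptional (hJ _ h))
  have hT : ∀ g ∈ J, -p + g ∈ ({-p, -(p + q), i + p, i + (p + q)} : Finset (ZMod n)) := by
    intro g hg
    have h := mem_exceptional.1 (hJ g hg)
    have h1 : -p + g ≠ -q := fun h => hp <| by
      have : p = g + q := by linear_combination -h
      exact this ▸ add_mem hg hq
    have h2 : -p + g ≠ i + q := fun h => hip <| by
      have : i + p = g - q := by linear_combination -h
      exact this ▸ sub_mem hg hq
    simp only [Finset.mem_insert, Finset.mem_singleton]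
    tauto
  have h3 := fun g (hg : g ∈ J) => three_mul_eq_zero hn Finset.card_le_four hT hg
  have hq0 : q ≠ 0 := fun h => h0 (by simp [mem_exceptional, h])
  have hi : i + 2 * p ∈ J := by
    have h1 := hT _ hq
    have h2 := hT _ (add_mem hq hq)
    simp only [Finset.mem_insert, Finset.mem_singleton] at h1 h2
    have h4 := eq_zero_of_add_self hn (x := q)
    have h5 : i + 2 * p = 0 ∨ i + 2 * p = -q ∨ i + 2 * p = q ∨ i + 2 * p = q + q := by grind
    rcases h5 with h | h | h | h <;> rw [h]
    exacts [zero_mem _, neg_mem hq, hq, add_mem hq hq]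
  right; right
  linear_combination h3 _ hi + 2 * h3 _ hq

/-- The case that `-p` and `-q` lie in a coset contained in the exceptional set; for `p = q` only
the nontriviality of the subgroup is used. -/
lemma related_of_sub_mem (hn : Odd n) (h0 : 0 ∉ exceptional i p q)
    (hJ : ∀ g ∈ J, -p + g ∈ exceptional i p q) (hpq : p - q ∈ J) (hne : J ≠ ⊥) :
    Related i (p + q) := by
  by_cases hq : q ∈ J
  · exact related_of_mem hn h0 hJ hq
  have hj : ∀ g ∈ J, -p + g ≠ -(p + q) := fun g hg h => hq <| by
    have : q = -g := by linear_combination h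
    exact this ▸ neg_mem hg
  by_cases hi : i + 2 * p ∈ J
  · have hT : ∀ g ∈ J, -p + g ∈ ({-p, -q, i + p, i + q} : Finset (ZMod n)) := by
      intro g hg
      have h := mem_exceptional.1 (hJ g hg)
      have h1 := hj g hg
      have h2 : -p + g ≠ i + (p + q) := fun h => hq <| by
        have : q = g - (i + 2 * p) := by linear_combination -h
        exact this ▸ sub_mem hg hi
      simp only [Finset.mem_insert, Finset.mem_singleton]
      tauto
    have h3 := fun g (hg : g ∈ J) => three_mul_eq_zero hn Finset.card_le_four hT hg
    left
    linear_combination h3 _ hi - h3 _ hpq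
  · have hT : ∀ g ∈ J, -p + g = -p ∨ -p + g = -q ∨ -p + g = i + (p + q) := by
      intro g hg
      have h := mem_exceptional.1 (hJ g hg)
      have h1 := hj g hg
      have h2 : -p + g ≠ i + p := fun h => hi <| by
        have : i + 2 * p = g := by linear_combination -h
        exact this ▸ hg
      have h4 : -p + g ≠ i + q := fun h => hi <| by
        have : i + 2 * p = g + (p - q) := by linear_combination -h
        exact this ▸ add_mem hg hpq
      tauto
    have h3 := fun g (hg : g ∈ J) => three_mul_eq_zero hn
      (h := -p) (T := {-p, -q, i + (p + q)}) (Finset.card_le_three.trans (by norm_num))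
      (fun g hg => by
        simpa only [Finset.mem_insert, Finset.mem_singleton] using hT g hg) hg
    obtain ⟨δ, hδ, hδ0⟩ := J.bot_or_exists_ne_zero.resolve_left hne
    -- If `p = q`, then the coset would have at most two elements.
    have hne' : p - q ≠ 0 := by
      intro hpq0
      have hδδ := mt (eq_zero_of_add_self hn (x := δ)) hδ0
      rcases hT _ hδ with h | h | h
      · exact hδ0 (by linear_combination h)
      · exact hδ0 (by linear_combination h + hpq0)
      rcases hT _ (add_mem hδ hδ) with h' | h' | h'
      · exact hδδ (by linear_combination h')
      · exact hδδ (by linear_combination h' + hpq0)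
      · exact hδ0 (by linear_combination h' - h)
    have h5 := h3 _ hpq
    have h6 : i = -3 * q := by
      rcases hT _ (add_mem hpq hpq) with h | h | h
      · exact absurd (eq_zero_of_add_self hn (by linear_combination h)) hne'
      · exact absurd (by linear_combination h) hne'
      · linear_combination -h
    right; left
    linear_combination 2 * h6 + h5

lemma related_of_mem_neg (hn : Odd n) (h0 : 0 ∉ exceptional i p q) {u v : ZMod n}
    (hJ : ∀ g ∈ J, u + g ∈ exceptional i p q) (huv : u - v ∈ J) (hne : u ≠ v)
    (hu : u ∈ ({-p, -q, -(p + q)} : Finset (ZMod n)))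
    (hv : v ∈ ({-p, -q, -(p + q)} : Finset (ZMod n))) :
    Related i (p + q) := by
  have hJv : ∀ g ∈ J, v + g ∈ exceptional i p q := fun g hg => by
    have := hJ _ (sub_mem hg huv)
    rwa [show u + (g - (u - v)) = v + g by abel] at this
  have hbot : J ≠ ⊥ := by
    rintro rfl
    exact hne (sub_eq_zero.1 huv)
  have hvu : v - u ∈ J := by simpa using neg_mem huv
  have h0' := h0
  rw [exceptional_comm] at h0'
  have hJ' := hJ
  have hJv' := hJv
  rw [exceptional_comm] at hJ' hJv'
  simp only [Finset.mem_insert, Finset.mem_singleton] at hu hv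
  rcases hu with rfl | rfl | rfl <;> rcases hv with rfl | rfl | rfl
  · exact absurd rfl hne
  · exact related_of_sub_mem hn h0 hJ (by simpa [sub_eq_add_neg, add_comm] using hvu) hbot
  · exact related_of_mem hn h0 hJ (by simpa using huv)
  · exact related_of_sub_mem hn h0 hJv (by simpa [sub_eq_add_neg, add_comm] using huv) hbot
  · exact absurd rfl hne
  · rw [add_comm]
    exact related_of_mem hn h0' hJ' (by simpa using huv)
  · exact related_of_mem hn h0 hJv (by simpa using hvu)
  · rw [add_comm]
    exact related_of_mem hn h0' hJv' (by simpa using hvu)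
  · exact absurd rfl hne

/-- If `0` is not exceptional, then the exceptional set is coset-free unless `i` and `p + q` are
related. Among any three elements of `exceptional i p q`, two come from `{-p, -q, -(p + q)}` or,
after the reflection `a ↦ i - a`, from this set. -/
lemma cosetFree_exceptional [NeZero n] (hn : Odd n) (h0 : 0 ∉ exceptional i p q)
    (hR : ¬ Related i (p + q)) : CosetFree (exceptional i p q) := by
  intro h δ hδ
  by_contra! hall
  set J := AddSubgroup.zmultiples δ
  have hJ : ∀ g ∈ J, h + g ∈ exceptional i p q := by
    intro g hg
    obtain ⟨k, rfl⟩ := mem_multiples_iff_mem_zmultiples.2 hg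
    exact hall k
  have hδJ : δ ∈ J := AddSubgroup.mem_zmultiples δ
  set A : Finset (ZMod n) := {-p, -q, -(p + q)} with hA
  have key : ∀ u v, u - h ∈ J → v - h ∈ J → u ≠ v →
      ¬ (u ∈ A ∧ v ∈ A) ∧ ¬ (i - u ∈ A ∧ i - v ∈ A) := by
    intro u v hu hv hne
    have hJu : ∀ g ∈ J, u + g ∈ exceptional i p q := fun g hg => by
      have := hJ _ (add_mem hu hg)
      rwa [show h + (u - h + g) = u + g by abel] at this
    have huv : u - v ∈ J := by simpa using sub_mem hu hv
    refine ⟨fun h' => hR (related_of_mem_neg hn h0 hJu huv hne h'.1 h'.2), fun h' =>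
      hR (related_of_mem_neg hn h0 (J := J) (u := i - u) (v := i - v) (fun g hg => ?_) ?_ (by simpa)
        h'.1 h'.2)⟩
    · have := sub_mem_exceptional (hJu _ (neg_mem hg))
      rwa [show i - (u + -g) = i - u + g by abel] at this
    · simpa using neg_mem huv
  have hmem : ∀ u ∈ exceptional i p q, u ∈ A ∨ i - u ∈ A := by
    intro u hu
    rw [mem_exceptional] at hu
    simp only [hA, Finset.mem_insert, Finset.mem_singleton]
    grind
  have hδ2 : δ + δ ≠ 0 := fun h => hδ (eq_zero_of_add_self hn h)
  have hδδ := add_mem hδJ hδJ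
  have k1 := key h (h + δ) (by simp) (by simpa) (by simpa)
  have k2 := key h (h + (δ + δ)) (by simp) (by simpa) (by simpa)
  have k3 := key (h + δ) (h + (δ + δ)) (by simpa) (by simpa) (by simpa)
  have m1 := hmem h (by simpa using hJ 0 (zero_mem _))
  have m2 := hmem _ (hJ _ hδJ)
  have m3 := hmem _ (hJ _ hδδ)
  rcases m1 with m1 | m1 <;> rcases m2 with m2 | m2
  · exact k1.1 ⟨m1, m2⟩
  · exact m3.elim (fun m3 => k2.1 ⟨m1, m3⟩) fun m3 => k3.2 ⟨m2, m3⟩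
  · exact m3.elim (fun m3 => k3.1 ⟨m2, m3⟩) fun m3 => k2.2 ⟨m1, m3⟩
  · exact k1.2 ⟨m1, m2⟩

end Coset

end Residues

end LieFamily

/-! ### The selective metabelian condition -/

namespace LieFamily

section Selective

variable {n : ℕ} {K L : Type*} [Field K] [LieRing L] [LieAlgebra K L]
  {𝓛 : ZMod n → Submodule K L}

/-- The exceptional residues are those for which a sum over a subsequence of `(a, i - a, p, q)`
which involves `p` or `q` and exactly one of `a` and `i - a` vanishes; the other sums do not depend
on `a`, apart from `a` and `i - a` themselves. -/
lemma isNegOneIndependent_of_notMem {i p q a : ZMod n} (hi : i ≠ 0) (ha : a ≠ 0) (hb : i - a ≠ 0)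
    (h0 : 0 ∉ exceptional i p q) (haE : a ∉ exceptional i p q) :
    IsNegOneIndependent ![a, i - a, p, q] := by
  intro s hs
  rw [mem_exceptional] at h0 haE
  push Not at h0 haE
  obtain ⟨h1, h2, h3, h4, h5, h6⟩ := h0
  obtain ⟨g1, g2, g3, g4, g5, g6⟩ := haE
  have hsum : ∑ k, (if k ∈ s then ![a, i - a, p, q] k else 0) = 0 := by simpa using hs
  simp only [Fin.sum_univ_four, Matrix.cons_val] at hsum
  by_cases s0 : 0 ∈ s <;> by_cases s1 : 1 ∈ s <;> by_cases s2 : 2 ∈ s <;> by_cases s3 : 3 ∈ s <;>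
    simp only [s0, s1, s2, s3, if_true, if_false] at hsum
  · exact absurd (by linear_combination -hsum) h6
  · exact absurd (by linear_combination -hsum) h4
  · exact absurd (by linear_combination -hsum) h5
  · exact absurd (by linear_combination hsum) hi
  · exact absurd (by linear_combination hsum) g3
  · exact absurd (by linear_combination hsum) g1
  · exact absurd (by linear_combination hsum) g2
  · exact absurd (by linear_combination hsum) ha
  · exact absurd (by linear_combination -hsum) g6
  · exact absurd (by linear_combination -hsum) g4
  · exact absurd (by linear_combination -hsum) g5
  · exact absurd (by linear_combination hsum) hb
  · exact absurd (by linear_combination hsum) h3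
  · exact absurd (by linear_combination hsum) h1
  · exact absurd (by linear_combination hsum) h2
  · ext k
    fin_cases k <;> simp [s0, s1, s2, s3]

variable [NeZero n]

/-- The elements which commute with `[u, v]` contain all products `[𝓛_a, 𝓛_{i-a}]`, except for
exceptional indices `a`. -/
lemma lie_lie_eq_zero (hn : Odd n) (h𝓛 : IsLie 𝓛) (hind : iSupIndep 𝓛) (h0 : 𝓛 0 = ⊥)
    (hsel : SelectiveMetabelian 𝓛) {m : ℕ} (hm : 6 ≤ m) {i p q : ZMod n}
    (hi : i ≠ 0) (hE : 0 ∉ exceptional i p q) (hR : ¬ Related i (p + q)) {x u v : L}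
    (hx : x ∈ derived 𝓛 (eliminationDepth m + 1) i) (hu : u ∈ 𝓛 p) (hv : v ∈ 𝓛 q) :
    ⁅⁅u, v⁆, x⁆ = 0 := by
  refine derived_apply_le h𝓛 hind h0 (cosetFree_exceptional hn hE hR)
    ((card_exceptional_le i p q).trans hm) (Y := LinearMap.ker (LieAlgebra.ad K L ⁅u, v⁆)) ?_ hx
  intro a ha y hy z hz
  rw [LinearMap.mem_ker, LieAlgebra.ad_apply, ← lie_skew, neg_eq_zero]
  rcases eq_or_ne a 0 with rfl | ha0
  · rw [h0, Submodule.mem_bot] at hy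
    simp [hy]
  rcases eq_or_ne (i - a) 0 with hb | hb
  · rw [hb, h0, Submodule.mem_bot] at hz
    simp [hz]
  exact hsel _ _ _ _ (isNegOneIndependent_of_notMem hi ha0 hb hE ha) y hy z hz u hu v hv

/-- Components with unrelated indices `i`, `j` commute: the elimination theorem reduces a product
`[x, y]` of elements of these components to products `[x, [u, v]]` with `u ∈ 𝓛_p`, `v ∈ 𝓛_q`,
`p + q = j`, and `p` different from `-i` and `i + j`. A second application, for fixed `u` and `v`,
shows that these vanish. -/
lemma lie_eq_zero_of_not_related (hn : Odd n) (h𝓛 : IsLie 𝓛) (hind : iSupIndep 𝓛) (h0 : 𝓛 0 = ⊥)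
    (hsel : SelectiveMetabelian 𝓛) {m : ℕ} (hm : 6 ≤ m) {i j : ZMod n} (hR : ¬ Related i j)
    {x y : L} (hx : x ∈ derived 𝓛 (eliminationDepth m + 1) i)
    (hy : y ∈ derived 𝓛 (eliminationDepth m + 1) j) : ⁅x, y⁆ = 0 := by
  have hz : ∀ {z}, z ∈ 𝓛 0 → z = 0 := fun h => by rwa [h0, Submodule.mem_bot] at h
  have hle := h𝓛.derived_le (eliminationDepth m + 1)
  rcases eq_or_ne i 0 with rfl | hi
  · rw [hz (hle _ hx), zero_lie]
  rcases eq_or_ne j 0 with rfl | hj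
  · rw [hz (hle _ hy), lie_zero]
  rcases eq_or_ne (i + j) 0 with hij | hij
  · exact hz (hij ▸ h𝓛 (hle _ hx) (hle _ hy))
  refine derived_apply_le h𝓛 hind h0 (cosetFree_pair hn (-i) (i + j))
    (Finset.card_le_two.trans (by omega)) (Y := LinearMap.ker (LieAlgebra.ad K L x)) ?_ hy
  intro p hp u hu v hv
  rw [LinearMap.mem_ker, LieAlgebra.ad_apply]
  rcases eq_or_ne p 0 with rfl | hp0
  · rw [hz hu, zero_lie, lie_zero]
  rcases eq_or_ne (j - p) 0 with hq | hq
  · rw [hq] at hv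
    rw [hz hv, lie_zero, lie_zero]
  simp only [Finset.mem_insert, Finset.mem_singleton, not_or] at hp
  rw [← lie_skew, neg_eq_zero]
  refine lie_lie_eq_zero hn h𝓛 hind h0 hsel hm hi ?_ (by rwa [add_sub_cancel]) hx hu hv
  rw [mem_exceptional]
  rintro (h | h | h | h | h | h)
  · exact hp0 (by linear_combination h)
  · exact hq (by linear_combination h)
  · exact hj (by linear_combination h)
  · exact hp.1 (by linear_combination -h)
  · exact hp.2 (by linear_combination h)
  · exact hij (by linear_combination -h)

/-- One step above the level at which components with unrelated indices commute, the only
nontrivial components are those whose indices are annihilated by `45`, so that Kreknin's theorem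
applies. -/
theorem derived_eq_bot (hn : Odd n) (h𝓛 : IsLie 𝓛) (hind : iSupIndep 𝓛) (h0 : 𝓛 0 = ⊥)
    (hsel : SelectiveMetabelian 𝓛) {m : ℕ} (hm : 45 ≤ m) :
    derived 𝓛 (kreknin m + (eliminationDepth m + 1 + 1)) = ⊥ := by
  have hcomm := fun {i j : ZMod n} (hR : ¬ Related i j) {x y : L} =>
    lie_eq_zero_of_not_related hn h𝓛 hind h0 hsel (m := m) (by omega) hR (x := x) (y := y)
  rw [derived_add, ← le_bot_iff]
  refine derived_kreknin_le (h𝓛.derived _) (fun a b x y hx _ => ?_)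
    ((h𝓛.derived_le _ 0).trans h0.le) (B := Finset.univ.filter fun a => 45 • a = 0)
    (fun s hs => ?_) ((IsAddCyclic.card_nsmul_eq_zero_le (by norm_num)).trans hm)
  · obtain rfl : x = 0 := hx.2
    rw [zero_lie]
    exact zero_mem _
  · rw [derived_succ]
    refine bracket_le fun i j hij x hx y hy => (Submodule.mem_bot K).2 ?_
    by_cases hR : Related i j
    · by_cases hR' : Related j i
      · have := hR.mul_eq_zero hn hR'
        exact absurd (by simpa [← hij] using this) hs
      · rw [← lie_skew, hcomm hR' hy hx, neg_zero]
    · exact hcomm hR hx hy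

end Selective

/-- The terms of the derived series of a graded Lie algebra are contained in the sums of the
components of the derived series of the family. -/
lemma derivedSeries_le_iSup_derived {A K L : Type*} [AddCommGroup A] [Field K] [LieRing L]
    [LieAlgebra K L] {𝓛 : A → Submodule K L} (htop : ⨆ a, 𝓛 a = ⊤) (k : ℕ) :
    (LieAlgebra.derivedSeries K L k).toSubmodule ≤ ⨆ a, derived 𝓛 k a := by
  induction k with
  | zero => rw [derived_zero, htop]; exact le_top
  | succ k ih =>
    rw [LieAlgebra.derivedSeries_def, LieAlgebra.derivedSeriesOfIdeal_succ,
      LieSubmodule.lieIdeal_oper_eq_linear_span', Submodule.span_le]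
    rintro _ ⟨x, hx, y, hy, rfl⟩
    refine Submodule.iSup_induction _ (motive := (⁅·, y⁆ ∈ ⨆ a, derived 𝓛 (k + 1) a)) (ih hx)
      (fun a u hu => ?_) (by simp) fun u v hu hv => by rw [add_lie]; exact add_mem hu hv
    refine Submodule.iSup_induction _ (motive := (⁅u, ·⁆ ∈ ⨆ a, derived 𝓛 (k + 1) a)) (ih hy)
      (fun b v hv => ?_) (by simp) fun v w hv hw => by rw [lie_add]; exact add_mem hv hw
    refine Submodule.mem_iSup_of_mem (a + b) ?_
    rw [derived_succ]
    exact lie_mem_bracket hu hv rfl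

end LieFamily

theorem mainTheorem2 :
    ∃ C : ℕ, ∀ (n : ℕ), Odd n →
      ∀ (K : Type*) (L : Type*) [Field K] [LieRing L] [LieAlgebra K L]
        (𝓛 : ZMod n → Submodule K L) [GradedLieAlgebra 𝓛],
        𝓛 0 = ⊥ → SelectiveMetabelian 𝓛 →
          LieAlgebra.derivedSeries K L C = ⊥ := by
  -- Any `m ≥ 45` serves, since the exceptional sets have at most six elements and at most `45`
  -- residues are annihilated by `45`. It is kept abstract, because the bound is astronomical.
  obtain ⟨m, hm⟩ : ∃ m, 45 ≤ m := ⟨45, le_rfl⟩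
  refine ⟨LieFamily.kreknin m + (LieFamily.eliminationDepth m + 1 + 1),
    fun n hn K L _ _ _ 𝓛 _ h0 hsel => ?_⟩
  have : NeZero n := ⟨hn.pos.ne'⟩
  have hint := DirectSum.Decomposition.isInternal 𝓛
  have h𝓛 : LieFamily.IsLie 𝓛 := fun _ _ _ _ hx hy => SetLike.GradedBracket.bracket_mem hx hy
  rw [← LieSubmodule.toSubmodule_eq_bot, ← le_bot_iff]
  refine (LieFamily.derivedSeries_le_iSup_derived hint.submodule_iSup_eq_top _).trans ?_
  rw [LieFamily.derived_eq_bot hn h𝓛 hint.submodule_iSupIndep h0 hsel hm]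
  exact iSup_le fun _ => le_rfl
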